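/- **Optimal decision tree.** There are $m\ge 2$ hypotheses $1,\dots,m$ with probabilities $p_i\ge 0$, $\sum_i p_i=1$, and a finite set $U$ of tests with arbitrary costs $c_e>0$. Test $e$ is positive for hypothesis $i$ iff $e\in S_i$, where $S_1,\dots,S_m\subseteq U$ are pairwise distinct (so that all tests together identify the true hypothesis). A solution is a binary decision tree whose internal nodes are labelled by tests, such that for every $i$ the set of tests on the path traced by $i$ distinguishes $i$ from every other hypothesis; its cost is the expected total cost of the tests on the path of the true hypothesis. For $e\in U$, $i\in[m]$ and $S\subseteq U$ let $$T_e(i)=\{j\in[m] : e\in S_i\,\triangle\, S_j\},\qquad f_i(S)=\frac{\bigl|\bigcup_{e\in S}T_e(i)\bigr|}{m-1}.$$ The greedy algorithm works with states $(E,H)$, where $E$ is the set of tests already performed and $H$ is the set of hypotheses $i$ that agree with all answers received and have $f_i(E)<1$; initially $E=\emptyset$, $H=[m]$. It stops when $H=\emptyset$; otherwise it performs a test $e\in U\setminus E$ maximizing $$\frac1{c_e}\Bigl(\sum_{j\in L_e(H)}p_j+\sum_{i\in H}p_i\,\frac{f_i(E\cup\{e\})-f_i(E)}{1-f_i(E)}\Bigr),$$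 where $L_e(H)$ is the smaller of the sets $\{i\in H:e\in S_i\}$ and $\{i\in H:e\notin S_i\}$. All ties are broken arbitrarily. There is an absolute constant $C>0$ such that the following holds for every such instance. 1. Each $f_i$ is monotone and submodular, takes values in $[0,1]$, and satisfies $f_i(\emptyset)=0$, $f_i(U)=1$; moreover $f_i(S)=1$ if and only if the tests in $S$ distinguish $i$ from every other hypothesis. 2. The minimum positive increment $\epsilon=\min\{f_i(S\cup\{e\})-f_i(S) : i\in[m],\,S\subseteq U,\,e\in U,\ f_i(S\cup\{e\})>f_i(S)\}$ equals $\frac1{m-1}$. 3. The greedy algorithm produces a decision tree, and every decision tree it can produce is a solution whose cost is at most $C\log m$ times the cost of every solution, in particular of an optimal one. The same holds if the cost of a tree is instead the expected cost of the shortest prefix $P$ of the path traced by the true hypothesis $i$ with $f_i(P)\ge 1$. -/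

import Mathlib

noncomputable section

/-- The data of an adaptive ranking problem with tests (elements) `U` and scenarios `ι`: the cost
of each element, the probability of each scenario, the interest set `S_i` of each scenario (the
elements on which scenario `i` answers "yes"), and the set function `f_i` which scenario `i` wants
to see covered. -/
structure ASRInstance (U ι : Type*) where
  cost : U → ℝ
  prob : ι → ℝ
  interest : ι → Finset U
  f : ι → Finset U → ℝ

/-- Binary decision trees with internal nodes labelled by elements; the first subtree is the
yes-branch, the second one the no-branch. -/
inductive DecTree (U : Type*) where
  | leaf : DecTree U
  | node (e : U) (yes no : DecTree U) : DecTree U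

/-- The sequence of elements on the root-leaf path traced by a scenario whose interest set
is `S`. -/
def DecTree.path {U : Type*} [DecidableEq U] : DecTree U → Finset U → List U
  | .leaf, _ => []
  | .node e yes no, S => e :: (if e ∈ S then yes.path S else no.path S)

namespace ASRInstance

variable {U ι : Type*} [DecidableEq U] [Fintype ι] (A : ASRInstance U ι)

/-- The standing assumptions on the data: positive costs, a probability distribution on the
scenarios, and set functions with values in `[0,1]` that are normalized, monotone and submodular. -/
def Valid [Fintype U] : Prop :=
  (∀ e, 0 < A.cost e) ∧ (∀ i, 0 ≤ A.prob i) ∧ ∑ i, A.prob i = 1 ∧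
  ∀ i, (∀ S, A.f i S ∈ Set.Icc (0 : ℝ) 1) ∧ A.f i ∅ = 0 ∧ A.f i Finset.univ = 1 ∧
    (∀ S T, S ⊆ T → A.f i S ≤ A.f i T) ∧
    (∀ S T, A.f i (S ∩ T) + A.f i (S ∪ T) ≤ A.f i S + A.f i T)

/-- The set of all positive incremental values of single elements; the parameter `ε` is its
minimum. -/
def positiveIncrements : Set ℝ :=
  {x | ∃ (i : ι) (S : Finset U) (e : U),
    A.f i S < A.f i (insert e S) ∧ x = A.f i (insert e S) - A.f i S}

/-- Every scenario is covered by the elements on the path that it traces. -/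
def IsSolution (t : DecTree U) : Prop :=
  ∀ i, 1 ≤ A.f i (t.path (A.interest i)).toFinset

/-- The length of the shortest prefix of the list `l` that covers scenario `i`. -/
def coverLength (i : ι) (l : List U) : ℕ :=
  sInf {k : ℕ | 1 ≤ A.f i (l.take k).toFinset}

/-- The cost of the shortest covering prefix of the path traced by scenario `i`. -/
def coverCost (t : DecTree U) (i : ι) : ℝ :=
  (((t.path (A.interest i)).take
    (A.coverLength i (t.path (A.interest i)))).map A.cost).sum

/-- The expected cost to cover the realized scenario. -/
def expectedCost (t : DecTree U) : ℝ :=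
  ∑ i, A.prob i * A.coverCost t i

/-- `P` is a set `L_e(H)`: a part of minimum cardinality among the two parts into which the answer
to `e` divides `H`. In case of a tie both parts qualify. -/
def IsMinorityPart (H : Finset ι) (e : U) (P : Finset ι) : Prop :=
  (P = H.filter (fun i => e ∈ A.interest i) ∧
    (H.filter (fun i => e ∈ A.interest i)).card ≤ (H.filter (fun i => e ∉ A.interest i)).card) ∨
  (P = H.filter (fun i => e ∉ A.interest i) ∧
    (H.filter (fun i => e ∉ A.interest i)).card ≤ (H.filter (fun i => e ∈ A.interest i)).card)

/-- The score of element `e` in state `(E, H)`, where `P` is the set `L_e(H)`. -/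
def score (E : Finset U) (H P : Finset ι) (e : U) : ℝ :=
  (1 / A.cost e) *
    (∑ j ∈ P, A.prob j +
      ∑ i ∈ H, A.prob i * ((A.f i (insert e E) - A.f i E) / (1 - A.f i E)))

/-- `A.GreedyFrom E H t`: the tree `t` is a possible continuation of the greedy algorithm from the
state in which `E` is the set of elements displayed so far and `H` the set of scenarios that are
compatible with the feedback and uncovered. The algorithm stops when `H` is empty; otherwise it
displays an element outside `E` of maximum score. Ties, in the choice of this element and in the
choice of the sets `L_e(H)`, may be broken in any way. -/
inductive GreedyFrom : Finset U → Finset ι → DecTree U → Prop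
  | done (E : Finset U) : GreedyFrom E ∅ DecTree.leaf
  | step (E : Finset U) (H : Finset ι) (L : U → Finset ι) (e : U) (yes no : DecTree U)
      (hH : H.Nonempty)
      (hL : ∀ e', A.IsMinorityPart H e' (L e'))
      (he : e ∉ E)
      (hmax : ∀ e', e' ∉ E → A.score E H (L e') e' ≤ A.score E H (L e) e)
      (hyes : GreedyFrom (insert e E)
        (H.filter (fun i => e ∈ A.interest i ∧ A.f i (insert e E) < 1)) yes)
      (hno : GreedyFrom (insert e E)
        (H.filter (fun i => e ∉ A.interest i ∧ A.f i (insert e E) < 1)) no) :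
      GreedyFrom E H (DecTree.node e yes no)

/-- `t` is a possible output of the greedy algorithm, which starts with no element displayed. -/
def IsGreedyTree (t : DecTree U) : Prop :=
  A.GreedyFrom ∅ (Finset.univ.filter (fun i => A.f i ∅ < 1)) t

end ASRInstance

/-- An instance of the optimal decision tree problem with tests `U` and hypotheses `Fin m`:
`positive i` is the set of tests that are positive for hypothesis `i`, and the true hypothesis can
be identified by performing all tests. -/
structure ODTInstance (U : Type*) (m : ℕ) where
  cost : U → ℝ
  cost_pos : ∀ e, 0 < cost e
  prob : Fin m → ℝ
  prob_nonneg : ∀ i, 0 ≤ prob i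
  prob_sum : ∑ i, prob i = 1
  positive : Fin m → Finset U
  identifiable : ∀ i j, i ≠ j → ∃ e, ¬ (e ∈ positive i ↔ e ∈ positive j)

namespace ODTInstance

variable {U : Type*} [DecidableEq U] {m : ℕ} (I : ODTInstance U m)

/-- Performing the tests in `S` determines that `i` is the true hypothesis if it is: every other
hypothesis gives a different answer to some test in `S`. -/
def Identifies (S : Finset U) (i : Fin m) : Prop :=
  ∀ j, j ≠ i → ∃ e ∈ S, ¬ (e ∈ I.positive i ↔ e ∈ I.positive j)

/-- A decision tree solves the problem if the tests on the path of each hypothesis identify it. -/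
def IsSolution (t : DecTree U) : Prop :=
  ∀ i, I.Identifies (t.path (I.positive i)).toFinset i

/-- The expected total cost of the tests performed. -/
def expectedCost (t : DecTree U) : ℝ :=
  ∑ i, I.prob i * ((t.path (I.positive i)).map I.cost).sum

/-- `T_e(i)`: the hypotheses that differ from `i` on test `e`. -/
def differ (e : U) (i : Fin m) : Finset (Fin m) :=
  Finset.univ.filter (fun j => e ∈ symmDiff (I.positive i) (I.positive j))

/-- The adaptive ranking instance with `f_i(S) = |⋃_{e ∈ S} T_e(i)| / (m - 1)`. -/
def toASR : ASRInstance U (Fin m) where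
  cost := I.cost
  prob := I.prob
  interest := I.positive
  f := fun i S => ((S.biUnion (fun e => I.differ e i)).card : ℝ) * (1 / ((m : ℝ) - 1))

end ODTInstance

end

/-! Fix any solution `s` and let o(i) be the cost at which `s` covers scenario i. The whole path
cost of a greedy tree is charged against o by three facts about each greedy state (E, H).

Rate of progress. Call cost times score the gain. Follow `s`, at each test e, into the part of H
complementary to L_e(H), as long as the cost stays within T (`exists_stem`). A scenario of H covered
by `s` within cost T either lies in some L_e on this stem, or is covered by the stem itself; in the
latter case submodularity makes its normalized increments along the stem sum to at least 1. So the
gains along the stem sum to at least the probability covered by T, and greediness gives cost(e) ·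
P(o ≤ T in H) ≤ gain(e) · T (`cost_mul_sum_prob_covered_le`).

Bounded total gain. The potential ∑ p_i (log₂|H| + 1 + log((1 - f_i(E))/ε)) drops at each step by at
least the gain (`gain_add_potential_le`): entering the minority part halves H, and the increments
are dominated by a logarithm.

Charging. Take T to be a weighted median of o on H, so that cost(e) · P(H) ≤ 2 · gain(e) · T, and
spread gain(e) uniformly over [0, T). Let Φ(x) collect the gains of all nodes of the greedy tree
with x < T. On each branch, the first such node has potential at most K · P(H), hence at most 2K ·
P(o > x in H); distinct branches have disjoint H. Thus Φ(x) ≤ 2K · P(o > x), and integrating in x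
bounds the greedy cost by 4K · E[o] (`GreedyFrom.exists_charge`, `IsGreedyTree.sum_cost_path_le`).

For decision trees ε = 1/(m-1), so K = O(log m). The bound compares the full path cost of greedy
with the covering-prefix cost of `s`, hence settles both cost notions at once. -/

namespace ASRInstance

variable {U ι : Type*} [DecidableEq U]

/-! ### Greedy states and the potential -/

/-- The scenarios in `H` gave the same answers to all elements of `E`, and none of them is covered
by `E`. -/
structure IsState (A : ASRInstance U ι) (E : Finset U) (H : Finset ι) : Prop where
  agree : ∀ i ∈ H, ∀ j ∈ H, ∀ e ∈ E, (e ∈ A.interest i ↔ e ∈ A.interest j)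
  uncovered : ∀ i ∈ H, A.f i E < 1

/-- The score of an element multiplied by its cost. -/
noncomputable def gain (A : ASRInstance U ι) (E : Finset U) (H P : Finset ι) (e : U) : ℝ :=
  ∑ j ∈ P, A.prob j + ∑ i ∈ H, A.prob i * ((A.f i (insert e E) - A.f i E) / (1 - A.f i E))

/-- An upper bound on the total gain of the greedy algorithm from the state `(E, H)` onwards. -/
noncomputable def potential (A : ASRInstance U ι) (ε : ℝ) (E : Finset U) (H : Finset ι) : ℝ :=
  ∑ i ∈ H, A.prob i * (Real.logb 2 H.card + 1 + Real.log ((1 - A.f i E) / ε))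

theorem IsState.yes {A : ASRInstance U ι} {E : Finset U} {H : Finset ι} (h : A.IsState E H)
    (e : U) : A.IsState (insert e E)
      (H.filter (fun i => e ∈ A.interest i ∧ A.f i (insert e E) < 1)) where
  agree i hi j hj e' he' := by
    simp only [Finset.mem_filter, Finset.mem_insert] at hi hj he'
    rcases he' with rfl | he'
    · tauto
    · exact h.agree i hi.1 j hj.1 e' he'
  uncovered i hi := (Finset.mem_filter.1 hi).2.2

theorem IsState.no {A : ASRInstance U ι} {E : Finset U} {H : Finset ι} (h : A.IsState E H)
    (e : U) : A.IsState (insert e E)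
      (H.filter (fun i => e ∉ A.interest i ∧ A.f i (insert e E) < 1)) where
  agree i hi j hj e' he' := by
    simp only [Finset.mem_filter, Finset.mem_insert] at hi hj he'
    rcases he' with rfl | he'
    · tauto
    · exact h.agree i hi.1 j hj.1 e' he'
  uncovered i hi := (Finset.mem_filter.1 hi).2.2

theorem IsMinorityPart.subset {A : ASRInstance U ι} {H P : Finset ι} {e : U}
    (h : A.IsMinorityPart H e P) : P ⊆ H := by
  rcases h with ⟨rfl, -⟩ | ⟨rfl, -⟩ <;> exact Finset.filter_subset _ _

/-- An element already displayed cannot split a state. Hence it has gain zero, which extends greedy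
maximality from elements outside `E` to every element of a competing tree. -/
theorem IsMinorityPart.eq_empty {A : ASRInstance U ι} {E : Finset U} {H P : Finset ι} {e : U}
    (h : A.IsMinorityPart H e P) (hs : A.IsState E H) (he : e ∈ E) : P = ∅ := by
  by_contra hP
  obtain ⟨i, hi⟩ := Finset.nonempty_iff_ne_empty.2 hP
  have key : (H.filter (fun i => e ∈ A.interest i)) = ∅ ∨
      (H.filter (fun i => e ∉ A.interest i)) = ∅ := by
    have hiH := h.subset hi
    by_cases hei : e ∈ A.interest i
    · right
      refine Finset.filter_eq_empty_iff.2 fun j hj => not_not.2 ?_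
      exact (hs.agree i hiH j hj e he).1 hei
    · left
      refine Finset.filter_eq_empty_iff.2 fun j hj hej => hei ?_
      exact (hs.agree i hiH j hj e he).2 hej
  rcases h with ⟨rfl, hc⟩ | ⟨rfl, hc⟩ <;> rcases key with k | k
  · exact hP k
  · rw [k, Finset.card_empty, Nat.le_zero, Finset.card_eq_zero] at hc; exact hP hc
  · rw [k, Finset.card_empty, Nat.le_zero, Finset.card_eq_zero] at hc; exact hP hc
  · exact hP k

theorem two_mul_card_le_of_isMinorityPart_yes {A : ASRInstance U ι} {H P : Finset ι} {e : U}
    (h : A.IsMinorityPart H e P) {i : ι} (hi : i ∈ P) (he : e ∈ A.interest i) :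
    2 * (H.filter (fun i => e ∈ A.interest i)).card ≤ H.card := by
  have hc := Finset.card_filter_add_card_filter_not (s := H) (fun i => e ∈ A.interest i)
  rcases h with ⟨rfl, h⟩ | ⟨rfl, h⟩
  · omega
  · exact absurd he (Finset.mem_filter.1 hi).2

theorem two_mul_card_le_of_isMinorityPart_no {A : ASRInstance U ι} {H P : Finset ι} {e : U}
    (h : A.IsMinorityPart H e P) {i : ι} (hi : i ∈ P) (he : e ∉ A.interest i) :
    2 * (H.filter (fun i => e ∉ A.interest i)).card ≤ H.card := by
  have hc := Finset.card_filter_add_card_filter_not (s := H) (fun i => e ∈ A.interest i)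
  rcases h with ⟨rfl, h⟩ | ⟨rfl, h⟩
  · exact absurd (Finset.mem_filter.1 hi).2 he
  · omega

theorem logb_add_le_logb {a b : ℕ} {x : ℝ} (ha : 0 < a) (hab : a ≤ b) (hx : x = 0 ∨ x = 1)
    (h : x = 1 → 2 * a ≤ b) : Real.logb 2 a + x ≤ Real.logb 2 b := by
  have ha' : (0 : ℝ) < a := by exact_mod_cast ha
  rcases hx with rfl | rfl
  · rw [add_zero]
    exact Real.logb_le_logb_of_le (by norm_num) ha' (by exact_mod_cast hab)
  · have h2 : Real.logb 2 (2 * (a : ℝ)) = Real.logb 2 a + 1 := by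
      rw [Real.logb_mul (by norm_num) ha'.ne', Real.logb_self_eq_one (by norm_num), add_comm]
    rw [← h2]
    exact Real.logb_le_logb_of_le (by norm_num) (by positivity) (by exact_mod_cast h rfl)

/-- The potential drop for one scenario: `x` marks membership in the minority part and `y`, `z` are
its coverage before and after. While `z < 1`, the increment is at most log((1-y)/(1-z)), by 1 - 1/u
≤ log u. The covering step has increment exactly 1, paid by the summand 1 of the potential. -/
theorem potential_step_le {a b : ℕ} {x y z ε : ℝ} (ha : 0 < a) (hab : a ≤ b)
    (hx : x = 0 ∨ x = 1) (h : x = 1 → 2 * a ≤ b) (hε : 0 < ε) (hy : 0 < 1 - y) (hz : z ≤ 1)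
    (hyε : ε ≤ 1 - y) :
    x + (z - y) / (1 - y) + (if z < 1 then Real.logb 2 a + 1 + Real.log ((1 - z) / ε) else 0) ≤
      Real.logb 2 b + 1 + Real.log ((1 - y) / ε) := by
  have hlog := logb_add_le_logb ha hab hx h
  split_ifs with hz1
  · have hz0 : 0 < 1 - z := by linarith
    have h1 : (z - y) / (1 - y) = 1 - (1 - z) / (1 - y) := by field_simp; ring
    have h2 := Real.one_sub_inv_le_log_of_pos (div_pos hy hz0)
    rw [inv_div, Real.log_div hy.ne' hz0.ne'] at h2
    rw [Real.log_div hy.ne' hε.ne', Real.log_div hz0.ne' hε.ne', h1]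
    linarith
  · have : z = 1 := le_antisymm hz (not_lt.1 hz1)
    subst this
    rw [div_self hy.ne']
    have h2 : 0 ≤ Real.log ((1 - y) / ε) := Real.log_nonneg (by rwa [one_le_div hε])
    have h3 : 0 ≤ Real.logb 2 a := Real.logb_nonneg (by norm_num) (by exact_mod_cast ha)
    linarith

theorem gain_add_potential_le [Fintype U] [Fintype ι] {A : ASRInstance U ι} (hA : A.Valid)
    {ε : ℝ} (hε : 0 < ε)
    (hinc : ∀ i S, A.f i S < 1 → ε ≤ 1 - A.f i S) {E : Finset U} {H P : Finset ι} {e : U}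
    (hs : A.IsState E H) (hP : A.IsMinorityPart H e P) :
    A.gain E H P e +
      (A.potential ε (insert e E)
        (H.filter (fun i => e ∈ A.interest i ∧ A.f i (insert e E) < 1)) +
      A.potential ε (insert e E)
        (H.filter (fun i => e ∉ A.interest i ∧ A.f i (insert e E) < 1))) ≤
      A.potential ε E H := by
  classical
  obtain ⟨-, hp, -, hf⟩ := hA
  have hPs : ∑ j ∈ P, A.prob j = ∑ i ∈ H, A.prob i * (if i ∈ P then 1 else 0) := by
    simp only [mul_ite, mul_one, mul_zero]
    rw [← Finset.sum_filter, Finset.filter_mem_eq_inter, Finset.inter_eq_right.2 hP.subset]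
  unfold gain potential
  rw [hPs, Finset.sum_filter, Finset.sum_filter, ← Finset.sum_add_distrib,
    ← Finset.sum_add_distrib, ← Finset.sum_add_distrib]
  refine Finset.sum_le_sum fun i hi => ?_
  have hx : (if i ∈ P then (1 : ℝ) else 0) = 0 ∨ (if i ∈ P then (1 : ℝ) else 0) = 1 := by
    split_ifs <;> simp
  have hx1 : (if i ∈ P then (1 : ℝ) else 0) = 1 → i ∈ P := by
    split_ifs with h <;> simp [h]
  have hu := hs.uncovered i hi
  by_cases he : e ∈ A.interest i
  · by_cases hz : A.f i (insert e E) < 1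
    · have hmem : i ∈ H.filter (fun i => e ∈ A.interest i ∧ A.f i (insert e E) < 1) := by
        simp [hi, he, hz]
      have hcc : (H.filter (fun i => e ∈ A.interest i ∧ A.f i (insert e E) < 1)).card ≤
          (H.filter (fun i => e ∈ A.interest i)).card :=
        Finset.card_le_card (Finset.monotone_filter_right _ fun _ _ h => h.1)
      have key := potential_step_le (Finset.card_pos.2 ⟨i, hmem⟩)
        (Finset.card_le_card (Finset.filter_subset _ _)) hx
        -- A scenario in the minority part lies in the smaller branch, so its own branch has at most
        -- half of `H`.
        (fun h => le_trans (by omega)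
          (two_mul_card_le_of_isMinorityPart_yes hP (hx1 h) he)) hε (by linarith)
        ((hf i).1 (insert e E)).2 (hinc i E hu)
      have := mul_le_mul_of_nonneg_left key (hp i)
      simp only [if_pos hz] at this
      simp only [he, hz, not_true_eq_false, false_and, and_self, if_true, if_false, add_zero]
      linarith
    · have hmem : i ∈ H.filter (fun i => e ∈ A.interest i) := by simp [hi, he]
      have key := potential_step_le (Finset.card_pos.2 ⟨i, hmem⟩)
        (Finset.card_le_card (Finset.filter_subset _ _)) hx
        (fun h => two_mul_card_le_of_isMinorityPart_yes hP (hx1 h) he) hε (by linarith)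
        ((hf i).1 (insert e E)).2 (hinc i E hu)
      have := mul_le_mul_of_nonneg_left key (hp i)
      simp only [if_neg hz] at this
      simp only [hz, and_false, if_false, add_zero]
      linarith
  · by_cases hz : A.f i (insert e E) < 1
    · have hmem : i ∈ H.filter (fun i => e ∉ A.interest i ∧ A.f i (insert e E) < 1) := by
        simp [hi, he, hz]
      have hcc : (H.filter (fun i => e ∉ A.interest i ∧ A.f i (insert e E) < 1)).card ≤
          (H.filter (fun i => e ∉ A.interest i)).card :=
        Finset.card_le_card (Finset.monotone_filter_right _ fun _ _ h => h.1)
      have key := potential_step_le (Finset.card_pos.2 ⟨i, hmem⟩)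
        (Finset.card_le_card (Finset.filter_subset _ _)) hx
        (fun h => le_trans (by omega)
          (two_mul_card_le_of_isMinorityPart_no hP (hx1 h) he)) hε (by linarith)
        ((hf i).1 (insert e E)).2 (hinc i E hu)
      have := mul_le_mul_of_nonneg_left key (hp i)
      simp only [if_pos hz] at this
      simp only [he, hz, not_false_eq_true, false_and, and_self, if_true, if_false, zero_add]
      linarith
    · have hmem : i ∈ H.filter (fun i => e ∉ A.interest i) := by simp [hi, he]
      have key := potential_step_le (Finset.card_pos.2 ⟨i, hmem⟩)
        (Finset.card_le_card (Finset.filter_subset _ _)) hx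
        (fun h => two_mul_card_le_of_isMinorityPart_no hP (hx1 h) he) hε (by linarith)
        ((hf i).1 (insert e E)).2 (hinc i E hu)
      have := mul_le_mul_of_nonneg_left key (hp i)
      simp only [if_neg hz] at this
      simp only [hz, and_false, if_false, add_zero]
      linarith

/-! ### Comparing a greedy step with an arbitrary solution -/

theorem exists_stem {A : ASRInstance U ι} (hc : ∀ e, 0 < A.cost e) {H : Finset ι} {L : U → Finset ι}
    (hL : ∀ e, A.IsMinorityPart H e (L e)) (s : DecTree U) (T : ℝ) (hT : 0 ≤ T) :
    ∃ l : List U, (l.map A.cost).sum ≤ T ∧ ∀ i ∈ H, (∀ e ∈ l, i ∉ L e) → ∀ k,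
      (((s.path (A.interest i)).take k).map A.cost).sum ≤ T →
      (s.path (A.interest i)).take k ⊆ l := by
  induction s generalizing T with
  | leaf => exact ⟨[], by simpa using hT, by simp [DecTree.path]⟩
  | node e yes no ihy ihn =>
    have hnn : ∀ l : List U, 0 ≤ (l.map A.cost).sum := fun l =>
      List.sum_nonneg (by simpa using fun a _ => (hc a).le)
    by_cases hcT : A.cost e ≤ T
    · have main : ∀ s' : DecTree U, (∀ i ∈ H, i ∉ L e → (DecTree.node e yes no).path (A.interest i) =
          e :: s'.path (A.interest i)) → (∃ l : List U, (l.map A.cost).sum ≤ T - A.cost e ∧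
          ∀ i ∈ H, (∀ e ∈ l, i ∉ L e) → ∀ k,
          (((s'.path (A.interest i)).take k).map A.cost).sum ≤ T - A.cost e →
          (s'.path (A.interest i)).take k ⊆ l) → ∃ l : List U, (l.map A.cost).sum ≤ T ∧
          ∀ i ∈ H, (∀ e ∈ l, i ∉ L e) → ∀ k,
          ((((DecTree.node e yes no).path (A.interest i)).take k).map A.cost).sum ≤ T →
          ((DecTree.node e yes no).path (A.interest i)).take k ⊆ l := by
        rintro s' hs' ⟨l, hl, hl'⟩
        refine ⟨e :: l, by simpa using (by linarith), fun i hi hil k => ?_⟩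
        rw [hs' i hi (hil e (by simp))]
        cases k with
        | zero => simp
        | succ k =>
          intro hk
          simp only [List.take_succ_cons, List.map_cons, List.sum_cons] at hk ⊢
          exact List.cons_subset_cons _
            (hl' i hi (fun e' he' => hil e' (by simp [he'])) k (by linarith))
      -- The stem continues into the branch opposite to `L e`, the one taken by scenarios of `H`
      -- outside `L e`.
      rcases hL e with ⟨h, -⟩ | ⟨h, -⟩
      · refine main no (fun i hi hiL => ?_) (ihn _ (by linarith))
        have : e ∉ A.interest i := fun h' => hiL (by rw [h]; simp [hi, h'])
        simp [DecTree.path, this]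
      · refine main yes (fun i hi hiL => ?_) (ihy _ (by linarith))
        have : e ∈ A.interest i := by
          by_contra h'
          exact hiL (by rw [h]; simp [hi, h'])
        simp [DecTree.path, this]
    · refine ⟨[], by simpa using hT, fun i _ _ k => ?_⟩
      cases k with
      | zero => simp
      | succ k =>
        intro hk
        simp only [DecTree.path, List.take_succ_cons, List.map_cons, List.sum_cons] at hk
        have := hnn ((if e ∈ A.interest i then yes.path (A.interest i)
          else no.path (A.interest i)).take k)
        linarith

theorem sub_le_sum_of_submodular {g : Finset U → ℝ} (hmono : ∀ S T, S ⊆ T → g S ≤ g T)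
    (hsub : ∀ S T, g (S ∩ T) + g (S ∪ T) ≤ g S + g T) (E : Finset U) (l : List U) :
    g (E ∪ l.toFinset) - g E ≤ (l.map fun e => g (insert e E) - g E).sum := by
  induction l with
  | nil => simp
  | cons e l ih =>
    have h1 := hsub (insert e E) (E ∪ l.toFinset)
    have h2 : g E ≤ g (insert e E ∩ (E ∪ l.toFinset)) := hmono _ _ (by
      intro x hx; simp [hx])
    have h3 : insert e E ∪ (E ∪ l.toFinset) = E ∪ (e :: l).toFinset := by
      ext x; simp
    rw [h3] at h1
    rw [List.map_cons, List.sum_cons]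
    linarith

end ASRInstance

namespace ASRInstance

variable {U ι : Type*} [DecidableEq U]

theorem one_le_f_take_coverLength {A : ASRInstance U ι} {s : DecTree U} (hs : A.IsSolution s)
    (i : ι) : 1 ≤ A.f i ((s.path (A.interest i)).take
      (A.coverLength i (s.path (A.interest i)))).toFinset :=
  Nat.sInf_mem (s := {k : ℕ | 1 ≤ A.f i ((s.path (A.interest i)).take k).toFinset})
    ⟨(s.path (A.interest i)).length, by simpa using hs i⟩

variable [Fintype ι]

theorem increment_nonneg [Fintype U] {A : ASRInstance U ι} (hA : A.Valid) (i : ι) (E : Finset U)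
    (e : U) : 0 ≤ (A.f i (insert e E) - A.f i E) / (1 - A.f i E) := by
  obtain ⟨-, -, -, hf⟩ := hA
  have h1 := ((hf i).1 E).2
  have h2 := (hf i).2.2.2.1 E (insert e E) (Finset.subset_insert _ _)
  exact div_nonneg (by linarith) (by linarith)

theorem gain_nonneg [Fintype U] {A : ASRInstance U ι} (hA : A.Valid) (E : Finset U)
    (H P : Finset ι) (e : U) : 0 ≤ A.gain E H P e :=
  add_nonneg (Finset.sum_nonneg fun i _ => hA.2.1 i)
    (Finset.sum_nonneg fun i _ => mul_nonneg (hA.2.1 i) (increment_nonneg hA i E e))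

theorem gain_mul_cost_le [Fintype U] {A : ASRInstance U ι} (hA : A.Valid) {E : Finset U}
    {H : Finset ι} {L : U → Finset ι} {e : U} (hs : A.IsState E H)
    (hL : ∀ e', A.IsMinorityPart H e' (L e'))
    (hmax : ∀ e', e' ∉ E → A.score E H (L e') e' ≤ A.score E H (L e) e) (e' : U) :
    A.gain E H (L e') e' * A.cost e ≤ A.gain E H (L e) e * A.cost e' := by
  by_cases he' : e' ∈ E
  · have : A.gain E H (L e') e' = 0 := by
      simp [gain, (hL e').eq_empty hs he', Finset.insert_eq_of_mem he']
    rw [this, zero_mul]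
    exact mul_nonneg (gain_nonneg hA _ _ _ _) (hA.1 e').le
  · have h : 1 / A.cost e' * A.gain E H (L e') e' ≤ 1 / A.cost e * A.gain E H (L e) e :=
      hmax e' he'
    rwa [one_div_mul_eq_div, one_div_mul_eq_div, div_le_div_iff₀ (hA.1 e') (hA.1 e)] at h

theorem sum_prob_covered_le [Fintype U] {A : ASRInstance U ι} (hA : A.Valid) {E : Finset U}
    {H : Finset ι} {L : U → Finset ι} (hs : A.IsState E H)
    (hL : ∀ e', A.IsMinorityPart H e' (L e')) {s : DecTree U} (hsol : A.IsSolution s) {T : ℝ}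
    {l : List U} (hl : ∀ i ∈ H, (∀ e ∈ l, i ∉ L e) → ∀ k,
      (((s.path (A.interest i)).take k).map A.cost).sum ≤ T →
      (s.path (A.interest i)).take k ⊆ l) :
    ∑ i ∈ H with A.coverCost s i ≤ T, A.prob i ≤ (l.map fun e => A.gain E H (L e) e).sum := by
  classical
  let F : U → ι → ℝ := fun e i =>
    (if i ∈ L e then 1 else 0) + (A.f i (insert e E) - A.f i E) / (1 - A.f i E)
  have hF : ∀ e i, 0 ≤ F e i := fun e i =>
    add_nonneg (by split_ifs <;> norm_num) (increment_nonneg hA i E e)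
  have hG : ∀ e, A.gain E H (L e) e = ∑ i ∈ H, A.prob i * F e i := by
    intro e
    simp only [F, gain, mul_add, Finset.sum_add_distrib, mul_ite, mul_one, mul_zero]
    rw [← Finset.sum_filter, Finset.filter_mem_eq_inter,
      Finset.inter_eq_right.2 (hL e).subset]
  have hsum : (l.map fun e => A.gain E H (L e) e).sum =
      ∑ i ∈ H, A.prob i * (l.map fun e => F e i).sum := by
    clear hl
    induction l with
    | nil => simp
    | cons e l ih =>
      rw [List.map_cons, List.sum_cons, ih, hG, ← Finset.sum_add_distrib]
      simp only [List.map_cons, List.sum_cons, mul_add]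
  rw [hsum, Finset.sum_filter]
  have hnn : ∀ i, ∀ x ∈ l.map (fun e => F e i), 0 ≤ x := by
    intro i x hx
    obtain ⟨e, -, rfl⟩ := List.mem_map.1 hx
    exact hF e i
  refine Finset.sum_le_sum fun i hi => ?_
  split_ifs with hT
  · refine le_mul_of_one_le_right (hA.2.1 i) ?_
    -- Either the scenario stays on the stem, which then covers it, or a single minority part
    -- already contributes 1.
    by_cases hil : ∀ e ∈ l, i ∉ L e
    · have hsub := hl i hi hil _ hT
      obtain ⟨hf1, -, -, hmono, hsubm⟩ := hA.2.2.2 i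
      have h1 : 1 ≤ A.f i (E ∪ l.toFinset) :=
        (one_le_f_take_coverLength hsol i).trans (hmono _ _ fun x hx =>
          Finset.mem_union_right _ (List.mem_toFinset.2 (hsub (List.mem_toFinset.1 hx))))
      have h2 := sub_le_sum_of_submodular hmono hsubm E l
      have h3 : 0 < 1 - A.f i E := by linarith [hs.uncovered i hi]
      have h4 : (l.map fun e => (A.f i (insert e E) - A.f i E) / (1 - A.f i E)).sum ≤
          (l.map fun e => F e i).sum :=
        List.sum_le_sum fun e _ => le_add_of_nonneg_left (by split_ifs <;> norm_num)
      refine le_trans ?_ h4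
      simp only [div_eq_mul_inv]
      rw [List.sum_map_mul_right, ← div_eq_mul_inv, one_le_div h3]
      linarith
    · push Not at hil
      obtain ⟨e, he, hie⟩ := hil
      refine le_trans ?_ (List.single_le_sum (hnn i) _ (List.mem_map_of_mem he))
      simp only [F, if_pos hie]
      linarith [increment_nonneg hA i E e]
  · exact mul_nonneg (hA.2.1 i) (List.sum_nonneg (hnn i))

theorem cost_mul_sum_prob_covered_le [Fintype U] {A : ASRInstance U ι} (hA : A.Valid)
    {E : Finset U} {H : Finset ι} {L : U → Finset ι} {e : U} (hs : A.IsState E H)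
    (hL : ∀ e', A.IsMinorityPart H e' (L e'))
    (hmax : ∀ e', e' ∉ E → A.score E H (L e') e' ≤ A.score E H (L e) e)
    {s : DecTree U} (hsol : A.IsSolution s) {T : ℝ} (hT : 0 ≤ T) :
    A.cost e * ∑ i ∈ H with A.coverCost s i ≤ T, A.prob i ≤ A.gain E H (L e) e * T := by
  obtain ⟨l, hlT, hl⟩ := exists_stem hA.1 hL s T hT
  calc A.cost e * ∑ i ∈ H with A.coverCost s i ≤ T, A.prob i
      ≤ A.cost e * (l.map fun e => A.gain E H (L e) e).sum :=
        mul_le_mul_of_nonneg_left (sum_prob_covered_le hA hs hL hsol hl) (hA.1 e).le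
    _ = (l.map fun e' => A.gain E H (L e') e' * A.cost e).sum := by
        rw [List.sum_map_mul_right, mul_comm]
    _ ≤ (l.map fun e' => A.gain E H (L e) e * A.cost e').sum :=
        List.sum_le_sum fun e' _ => gain_mul_cost_le hA hs hL hmax e'
    _ = A.gain E H (L e) e * (l.map A.cost).sum := by rw [List.sum_map_mul_left]
    _ ≤ A.gain E H (L e) e * T := mul_le_mul_of_nonneg_left hlT (gain_nonneg hA _ _ _ _)

/-- A weighted median of `o` on `H`. -/
theorem exists_weighted_median {ι : Type*} {H : Finset ι} (hH : H.Nonempty) {p : ι → ℝ}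
    (hp : ∀ i, 0 ≤ p i) (o : ι → ℝ) :
    ∃ j ∈ H, ∑ i ∈ H, p i ≤ 2 * ∑ i ∈ H with o i ≤ o j, p i ∧
      ∀ x < o j, ∑ i ∈ H, p i ≤ 2 * ∑ i ∈ H with x < o i, p i := by
  classical
  let V := H.filter fun j => ∑ i ∈ H, p i ≤ 2 * ∑ i ∈ H with o i ≤ o j, p i
  have hnn : 0 ≤ ∑ i ∈ H, p i := Finset.sum_nonneg fun i _ => hp i
  have hV : V.Nonempty := by
    obtain ⟨j, hj, hmax⟩ := H.exists_max_image o hH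
    refine ⟨j, Finset.mem_filter.2 ⟨hj, ?_⟩⟩
    rw [Finset.filter_true_of_mem hmax]
    linarith
  obtain ⟨j, hj, hmin⟩ := V.exists_min_image o hV
  refine ⟨j, (Finset.mem_filter.1 hj).1, (Finset.mem_filter.1 hj).2, fun x hx => ?_⟩
  -- `j` has the least value with at least half of the weight at or below it. Were half of the
  -- weight at or below some `x < o j`, the largest value of `o` not exceeding `x` would contradict
  -- minimality.
  by_contra! hlt
  have hsplit := Finset.sum_filter_add_sum_filter_not H (fun i => x < o i) p
  simp only [not_lt] at hsplit
  rcases (H.filter fun i => o i ≤ x).eq_empty_or_nonempty with h0 | h0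
  · rw [h0, Finset.sum_empty] at hsplit
    linarith
  · obtain ⟨k, hk, hmax⟩ := Finset.exists_max_image _ o h0
    have hkH := (Finset.mem_filter.1 hk).1
    have hkx := (Finset.mem_filter.1 hk).2
    have heq : H.filter (fun i => o i ≤ x) = H.filter fun i => o i ≤ o k := by
      refine Finset.filter_congr fun i hi => ⟨fun h => hmax i (by simp [hi, h]), fun h => h.trans hkx⟩
    have hkV : k ∈ V := by
      refine Finset.mem_filter.2 ⟨hkH, ?_⟩
      rw [← heq]
      linarith
    have := hmin k hkV
    linarith

end ASRInstance

/-! ### Charging the greedy cost to the competing solution -/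

namespace ASRInstance

theorem sum_cost_nonneg {U ι : Type*} {A : ASRInstance U ι} (hc : ∀ e, 0 < A.cost e) (l : List U) :
    0 ≤ (l.map A.cost).sum :=
  List.sum_nonneg (by simpa using fun a _ => (hc a).le)

variable {U ι : Type*} [DecidableEq U]

theorem integral_ite_lt {T B g : ℝ} (hT : 0 ≤ T) (hTB : T ≤ B) (hg : 0 ≤ g) :
    IntervalIntegrable (fun x => if x < T then g else 0) MeasureTheory.volume 0 B ∧
      ∫ x in (0 : ℝ)..B, (if x < T then g else 0) = g * T := by
  refine ⟨Antitone.intervalIntegrable fun x y hxy => ?_, ?_⟩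
  · split_ifs with h1 h2
    · exact le_rfl
    · exact absurd (hxy.trans_lt h1) h2
    · exact hg
    · exact le_rfl
  · have h : (fun x => if x < T then g else 0) = (Set.Iio T).indicator fun _ => g := by
      ext x; simp [Set.indicator_apply]
    rw [h, intervalIntegral.integral_of_le (hT.trans hTB),
      MeasureTheory.setIntegral_indicator measurableSet_Iio]
    have h2 : Set.Ioc 0 B ∩ Set.Iio T = Set.Ioo 0 T := by
      ext x
      simp only [Set.mem_inter_iff, Set.mem_Ioc, Set.mem_Iio, Set.mem_Ioo]
      constructor
      · tauto
      · intro h; exact ⟨⟨h.1, (h.2.le.trans hTB)⟩, h.2⟩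
    rw [h2, MeasureTheory.setIntegral_const]
    simp [hT, mul_comm]

theorem coverCost_nonneg {A : ASRInstance U ι} (hc : ∀ e, 0 < A.cost e) (s : DecTree U) (i : ι) :
    0 ≤ A.coverCost s i :=
  sum_cost_nonneg hc _

theorem coverCost_le {A : ASRInstance U ι} (hc : ∀ e, 0 < A.cost e) (s : DecTree U) (i : ι) :
    A.coverCost s i ≤ ((s.path (A.interest i)).map A.cost).sum :=
  ((List.take_sublist _ _).map A.cost).sum_le_sum (by simpa using fun a _ => (hc a).le)

theorem GreedyFrom.eq_leaf {A : ASRInstance U ι} {E : Finset U} {t : DecTree U}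
    (h : A.GreedyFrom E ∅ t) : t = DecTree.leaf := by
  cases h with
  | done => rfl
  | step _ _ _ _ _ _ hH => exact absurd hH Finset.not_nonempty_empty

theorem exists_isMinorityPart (A : ASRInstance U ι) (H : Finset ι) (e : U) :
    ∃ P, A.IsMinorityPart H e P := by
  rcases le_total (H.filter (fun i => e ∈ A.interest i)).card
    (H.filter (fun i => e ∉ A.interest i)).card with h | h
  · exact ⟨_, Or.inl ⟨rfl, h⟩⟩
  · exact ⟨_, Or.inr ⟨rfl, h⟩⟩

/-- By `hcov`, scenarios with equal answers are covered together. Once one is covered, its branch of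
the state is empty and the subtree is a leaf, so a covered scenario pays for nothing further. -/
theorem sum_prob_mul_cost_path_node {A : ASRInstance U ι}
    (hcov : ∀ i j E, (∀ e ∈ E, (e ∈ A.interest i ↔ e ∈ A.interest j)) →
      1 ≤ A.f i E → 1 ≤ A.f j E)
    {E : Finset U} {H : Finset ι} (hs : A.IsState E H) {e : U} {yes no : DecTree U}
    (hyes : A.GreedyFrom (insert e E)
      (H.filter fun i => e ∈ A.interest i ∧ A.f i (insert e E) < 1) yes)
    (hno : A.GreedyFrom (insert e E)
      (H.filter fun i => e ∉ A.interest i ∧ A.f i (insert e E) < 1) no) :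
    ∑ i ∈ H, A.prob i * (((DecTree.node e yes no).path (A.interest i)).map A.cost).sum =
      A.cost e * ∑ i ∈ H, A.prob i +
      (∑ i ∈ H with e ∈ A.interest i ∧ A.f i (insert e E) < 1,
        A.prob i * ((yes.path (A.interest i)).map A.cost).sum +
      ∑ i ∈ H with e ∉ A.interest i ∧ A.f i (insert e E) < 1,
        A.prob i * ((no.path (A.interest i)).map A.cost).sum) := by
  rw [Finset.mul_sum, Finset.sum_filter, Finset.sum_filter, ← Finset.sum_add_distrib,
    ← Finset.sum_add_distrib]
  refine Finset.sum_congr rfl fun i hi => ?_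
  by_cases he : e ∈ A.interest i <;> by_cases hz : A.f i (insert e E) < 1
  · simp [DecTree.path, he, hz]; ring
  · have hempty : H.filter (fun j => e ∈ A.interest j ∧ A.f j (insert e E) < 1) = ∅ := by
      refine Finset.filter_eq_empty_iff.2 fun j hj hj' => hj'.2.not_ge
        (hcov i j _ (fun e' he' => ?_) (not_lt.1 hz))
      rcases Finset.mem_insert.1 he' with rfl | he'
      · tauto
      · exact hs.agree i hi j hj e' he'
    rw [hempty] at hyes
    simp [DecTree.path, he, hz, hyes.eq_leaf]
    ring
  · simp [DecTree.path, he, hz]; ring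
  · have hempty : H.filter (fun j => e ∉ A.interest j ∧ A.f j (insert e E) < 1) = ∅ := by
      refine Finset.filter_eq_empty_iff.2 fun j hj hj' => hj'.2.not_ge
        (hcov i j _ (fun e' he' => ?_) (not_lt.1 hz))
      rcases Finset.mem_insert.1 he' with rfl | he'
      · tauto
      · exact hs.agree i hi j hj e' he'
    rw [hempty] at hno
    simp [DecTree.path, he, hz, hno.eq_leaf]
    ring

variable [Fintype ι]

theorem potential_le [Fintype U] {A : ASRInstance U ι} (hA : A.Valid) {ε : ℝ} (hε : 0 < ε)
    {E : Finset U} {H : Finset ι} (hs : A.IsState E H) :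
    A.potential ε E H ≤
      (Real.logb 2 (Fintype.card ι) + 1 + Real.log (1 / ε)) * ∑ i ∈ H, A.prob i := by
  rw [Finset.mul_sum]
  refine Finset.sum_le_sum fun i hi => ?_
  rw [mul_comm]
  refine mul_le_mul_of_nonneg_right ?_ (hA.2.1 i)
  have h1 : Real.logb 2 H.card ≤ Real.logb 2 (Fintype.card ι) :=
    Real.logb_le_logb_of_le (by norm_num)
      (by exact_mod_cast Finset.card_pos.2 ⟨i, hi⟩) (by exact_mod_cast H.card_le_univ)
  have h0 := ((hA.2.2.2 i).1 E).1
  have h2 : Real.log ((1 - A.f i E) / ε) ≤ Real.log (1 / ε) :=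
    Real.log_le_log (div_pos (by linarith [hs.uncovered i hi]) hε)
      (div_le_div_of_nonneg_right (by linarith) hε.le)
  linarith

theorem sum_filter_add_sum_filter_le [Fintype U] {A : ASRInstance U ι} (hA : A.Valid)
    (E : Finset U) (H : Finset ι) (e : U) (q : ι → Prop) [DecidablePred q] :
    (∑ i ∈ (H.filter fun i => e ∈ A.interest i ∧ A.f i (insert e E) < 1) with q i, A.prob i) +
      ∑ i ∈ (H.filter fun i => e ∉ A.interest i ∧ A.f i (insert e E) < 1) with q i, A.prob i ≤
      ∑ i ∈ H with q i, A.prob i := by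
  simp only [Finset.sum_filter]
  rw [← Finset.sum_add_distrib]
  refine Finset.sum_le_sum fun i _ => ?_
  have := hA.2.1 i
  split_ifs <;> first | linarith | tauto

/-- The bound on `Φ` by the potential is carried only for the induction: it gives the tail bound at
a node whose median exceeds `x`, where the bounds of the two subtrees do not suffice. -/
theorem GreedyFrom.exists_charge [Fintype U] {A : ASRInstance U ι} (hA : A.Valid) {ε : ℝ}
    (hε : 0 < ε) (hinc : ∀ i S, A.f i S < 1 → ε ≤ 1 - A.f i S)
    (hcov : ∀ i j E, (∀ e ∈ E, (e ∈ A.interest i ↔ e ∈ A.interest j)) →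
      1 ≤ A.f i E → 1 ≤ A.f j E)
    {s : DecTree U} (hsol : A.IsSolution s) {B K : ℝ} (hB : ∀ i, A.coverCost s i ≤ B)
    (hK0 : 0 ≤ K)
    (hK : ∀ E H, A.IsState E H → A.potential ε E H ≤ K * ∑ i ∈ H, A.prob i)
    {E : Finset U} {H : Finset ι} {t : DecTree U} (h : A.GreedyFrom E H t)
    (hs : A.IsState E H) :
    ∃ Φ : ℝ → ℝ, IntervalIntegrable Φ MeasureTheory.volume 0 B ∧
      (∀ x, Φ x ≤ A.potential ε E H) ∧
      (∀ x, Φ x ≤ 2 * K * ∑ i ∈ H with x < A.coverCost s i, A.prob i) ∧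
      ∑ i ∈ H, A.prob i * ((t.path (A.interest i)).map A.cost).sum ≤
        2 * ∫ x in (0 : ℝ)..B, Φ x := by
  induction h with
  | done E =>
    exact ⟨fun _ => 0, by simp, by simp [potential], by simp, by simp⟩
  | step E H L e yes no hH hL he hmax hyes hno ihy ihn =>
    obtain ⟨Φy, hiy, hpy, hcy, hsy⟩ := ihy (hs.yes e)
    obtain ⟨Φn, hin, hpn, hcn, hsn⟩ := ihn (hs.no e)
    obtain ⟨j, hj, hj1, hj2⟩ := exists_weighted_median hH hA.2.1 (A.coverCost s)
    set T := A.coverCost s j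
    set g := A.gain E H (L e) e with hg
    have hT0 : 0 ≤ T := coverCost_nonneg hA.1 s j
    have hg0 : 0 ≤ g := gain_nonneg hA _ _ _ _
    obtain ⟨hint, hval⟩ := integral_ite_lt hT0 (hB j) hg0
    have hpot := gain_add_potential_le hA hε hinc hs (hL e)
    rw [← hg] at hpot
    have hle : ∀ x, (if x < T then g else 0) + (Φy x + Φn x) ≤ A.potential ε E H := by
      intro x
      have h1 : (if x < T then g else 0) ≤ g := by split_ifs <;> linarith
      linarith [hpy x, hpn x]
    refine ⟨fun x => (if x < T then g else 0) + (Φy x + Φn x), hint.add (hiy.add hin), hle,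
      fun x => ?_, ?_⟩
    · by_cases hx : x < T
      · calc _ ≤ A.potential ε E H := hle x
          _ ≤ K * ∑ i ∈ H, A.prob i := hK E H hs
          _ ≤ K * (2 * ∑ i ∈ H with x < A.coverCost s i, A.prob i) :=
            mul_le_mul_of_nonneg_left (hj2 x hx) hK0
          _ = _ := by ring
      · have h2 := mul_le_mul_of_nonneg_left
          (sum_filter_add_sum_filter_le hA E H e fun i => x < A.coverCost s i)
          (by positivity : 0 ≤ 2 * K)
        rw [mul_add] at h2
        simp only [if_neg hx, zero_add]
        linarith [hcy x, hcn x]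
    · have hcost := cost_mul_sum_prob_covered_le hA hs hL hmax hsol hT0
      rw [← hg] at hcost
      have h3 := mul_le_mul_of_nonneg_left hj1 (hA.1 e).le
      rw [sum_prob_mul_cost_path_node hcov hs hyes hno,
        intervalIntegral.integral_add hint (hiy.add hin), intervalIntegral.integral_add hiy hin,
        hval]
      linarith

theorem IsGreedyTree.sum_cost_path_le [Fintype U] {A : ASRInstance U ι} (hA : A.Valid) {ε : ℝ}
    (hε : 0 < ε) (hε1 : ε ≤ 1) (hinc : ∀ i S, A.f i S < 1 → ε ≤ 1 - A.f i S)
    (hcov : ∀ i j E, (∀ e ∈ E, (e ∈ A.interest i ↔ e ∈ A.interest j)) →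
      1 ≤ A.f i E → 1 ≤ A.f j E)
    {t : DecTree U} (ht : A.IsGreedyTree t) {s : DecTree U} (hsol : A.IsSolution s) :
    ∑ i, A.prob i * ((t.path (A.interest i)).map A.cost).sum ≤
      4 * (Real.logb 2 (Fintype.card ι) + 1 + Real.log (1 / ε)) * A.expectedCost s := by
  set K := Real.logb 2 (Fintype.card ι) + 1 + Real.log (1 / ε)
  have hK0 : 0 ≤ K := by
    have h1 : 0 ≤ Real.logb 2 (Fintype.card ι) := by
      rcases Nat.eq_zero_or_pos (Fintype.card ι) with h | h
      · simp [h]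
      · exact Real.logb_nonneg (by norm_num) (by exact_mod_cast h)
    have h2 : 0 ≤ Real.log (1 / ε) := Real.log_nonneg (by rwa [one_le_div hε])
    positivity
  have huniv : Finset.univ.filter (fun i => A.f i ∅ < 1) = Finset.univ :=
    Finset.filter_true_of_mem fun i _ => by rw [(hA.2.2.2 i).2.1]; norm_num
  unfold IsGreedyTree at ht
  rw [huniv] at ht
  have hs : A.IsState ∅ Finset.univ :=
    ⟨by simp, fun i _ => by rw [(hA.2.2.2 i).2.1]; norm_num⟩
  have hnn := fun i => coverCost_nonneg hA.1 s i
  -- Any common upper bound on the cover costs would do; it only makes the interval of integration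
  -- finite.
  set B := ∑ i, A.coverCost s i
  have hB : ∀ i, A.coverCost s i ≤ B := fun i =>
    Finset.single_le_sum (f := A.coverCost s) (fun i _ => hnn i) (Finset.mem_univ i)
  have hB0 : 0 ≤ B := Finset.sum_nonneg fun i _ => hnn i
  obtain ⟨Φ, hi, -, hΦ, hcost⟩ := ht.exists_charge hA hε hinc hcov hsol hB hK0
    (fun E H h => potential_le hA hε h) hs
  have hite := fun i => integral_ite_lt (hnn i) (hB i) (hA.2.1 i)
  have hint : IntervalIntegrable
      (fun x => 2 * K * ∑ i, if x < A.coverCost s i then A.prob i else 0)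
      MeasureTheory.volume 0 B := by
    have := (IntervalIntegrable.sum Finset.univ fun i _ => (hite i).1).const_mul (2 * K)
    simpa only [Finset.sum_apply] using this
  have hmono := intervalIntegral.integral_mono hB0 hi hint fun x => by
    have := hΦ x
    rwa [Finset.sum_filter] at this
  rw [intervalIntegral.integral_const_mul,
    intervalIntegral.integral_finsetSum fun i _ => (hite i).1] at hmono
  -- The integral of the tail probabilities of the cover cost is its expectation.
  simp only [(hite _).2] at hmono
  unfold expectedCost
  linarith

/-! ### Correctness and existence of greedy trees -/

theorem GreedyFrom.covers [Fintype U] {A : ASRInstance U ι} (hA : A.Valid)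
    {E : Finset U} {H : Finset ι} {t : DecTree U} (h : A.GreedyFrom E H t) :
    ∀ i ∈ H, 1 ≤ A.f i (E ∪ (t.path (A.interest i)).toFinset) := by
  induction h with
  | done E => simp
  | step E H L e yes no hH hL he hmax hyes hno ihy ihn =>
    intro i hi
    by_cases hz : A.f i (insert e E) < 1
    · by_cases hei : e ∈ A.interest i
      · have := ihy i (by simp [hi, hei, hz])
        simpa [DecTree.path, hei, Finset.insert_union, Finset.union_insert] using this
      · have := ihn i (by simp [hi, hei, hz])
        simpa [DecTree.path, hei, Finset.insert_union, Finset.union_insert] using this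
    · refine (not_lt.1 hz).trans ((hA.2.2.2 i).2.2.2.1 _ _ ?_)
      simp [DecTree.path, Finset.union_insert, Finset.insert_subset_insert]

theorem IsGreedyTree.isSolution [Fintype U] {A : ASRInstance U ι} (hA : A.Valid) {t : DecTree U}
    (ht : A.IsGreedyTree t) : A.IsSolution t := by
  intro i
  have := ht.covers hA i (by simp [(hA.2.2.2 i).2.1])
  simpa using this

theorem exists_greedyFrom [Fintype U] {A : ASRInstance U ι} (hA : A.Valid) (E : Finset U)
    (H : Finset ι) (hH : ∀ i ∈ H, A.f i E < 1) : ∃ t, A.GreedyFrom E H t := by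
  induction hn : Eᶜ.card using Nat.strong_induction_on generalizing E H with
  | _ n ih =>
    subst hn
    rcases H.eq_empty_or_nonempty with rfl | hne
    · exact ⟨_, .done E⟩
    choose L hL using A.exists_isMinorityPart H
    have hE : Eᶜ.Nonempty := by
      obtain ⟨i, hi⟩ := hne
      rw [Finset.nonempty_iff_ne_empty, Ne, Finset.compl_eq_empty_iff]
      rintro rfl
      exact (hH i hi).ne (hA.2.2.2 i).2.2.1
    obtain ⟨e, he, hmax⟩ := Eᶜ.exists_max_image (fun e => A.score E H (L e) e) hE
    have hlt : (insert e E)ᶜ.card < Eᶜ.card := by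
      refine Finset.card_lt_card ((Finset.ssubset_iff_of_subset ?_).2 ⟨e, he, by simp⟩)
      exact Finset.compl_subset_compl.2 (Finset.subset_insert _ _)
    obtain ⟨yes, hyes⟩ := ih _ hlt (insert e E)
      (H.filter fun i => e ∈ A.interest i ∧ A.f i (insert e E) < 1)
      (fun i hi => (Finset.mem_filter.1 hi).2.2) rfl
    obtain ⟨no, hno⟩ := ih _ hlt (insert e E)
      (H.filter fun i => e ∉ A.interest i ∧ A.f i (insert e E) < 1)
      (fun i hi => (Finset.mem_filter.1 hi).2.2) rfl
    exact ⟨_, .step E H L e yes no hne hL (Finset.mem_compl.1 he)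
      (fun e' he' => hmax e' (Finset.mem_compl.2 he')) hyes hno⟩

end ASRInstance

/-! ### Decision trees as adaptive ranking -/

namespace ODTInstance

variable {U : Type*} [DecidableEq U] {m : ℕ}

theorem mem_differ (I : ODTInstance U m) {e : U} {i j : Fin m} :
    j ∈ I.differ e i ↔ ¬ (e ∈ I.positive i ↔ e ∈ I.positive j) := by
  simp only [differ, Finset.mem_filter, Finset.mem_univ, true_and, Finset.mem_symmDiff]
  tauto

/-- The hypotheses that the tests in `S` distinguish from `i`. -/
def separated (I : ODTInstance U m) (i : Fin m) (S : Finset U) : Finset (Fin m) :=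
  S.biUnion fun e => I.differ e i

theorem mem_separated (I : ODTInstance U m) {i j : Fin m} {S : Finset U} :
    j ∈ I.separated i S ↔ ∃ e ∈ S, ¬ (e ∈ I.positive i ↔ e ∈ I.positive j) := by
  simp only [separated, Finset.mem_biUnion, mem_differ]

theorem separated_mono (I : ODTInstance U m) (i : Fin m) {S T : Finset U} (h : S ⊆ T) :
    I.separated i S ⊆ I.separated i T :=
  Finset.biUnion_subset_biUnion_of_subset_left _ h

theorem separated_subset (I : ODTInstance U m) (i : Fin m) (S : Finset U) :
    I.separated i S ⊆ Finset.univ.erase i := by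
  intro j hj
  obtain ⟨e, -, he⟩ := I.mem_separated.1 hj
  simp only [Finset.mem_erase, Finset.mem_univ, and_true]
  rintro rfl
  exact he Iff.rfl

theorem card_separated_le (I : ODTInstance U m) (i : Fin m) (S : Finset U) :
    (I.separated i S).card ≤ m - 1 := by
  simpa using Finset.card_le_card (I.separated_subset i S)

theorem card_separated_eq_iff (I : ODTInstance U m) (i : Fin m) (S : Finset U) :
    (I.separated i S).card = m - 1 ↔ I.Identifies S i := by
  have hcard : (Finset.univ.erase i).card = m - 1 := by simp
  rw [← hcard]
  constructor
  · intro h j hj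
    have := Finset.eq_of_subset_of_card_le (I.separated_subset i S) h.ge
    rw [← I.mem_separated, this]
    simpa using hj
  · intro h
    congr 1
    refine (I.separated_subset i S).antisymm fun j hj => I.mem_separated.2 (h j ?_)
    simpa using hj

theorem toASR_f (I : ODTInstance U m) (i : Fin m) (S : Finset U) :
    I.toASR.f i S = ((I.separated i S).card : ℝ) * (1 / ((m : ℝ) - 1)) := rfl

theorem toASR_f_eq_one_iff (I : ODTInstance U m) (hm : 2 ≤ m) (i : Fin m) (S : Finset U) :
    I.toASR.f i S = 1 ↔ I.Identifies S i := by
  have hm1 : ((m - 1 : ℕ) : ℝ) = (m : ℝ) - 1 := by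
    rw [Nat.cast_sub (by omega), Nat.cast_one]
  have hpos : (0 : ℝ) < ((m - 1 : ℕ) : ℝ) := by exact_mod_cast (by omega : 0 < m - 1)
  rw [← card_separated_eq_iff, toASR_f, ← hm1, mul_one_div, div_eq_one_iff_eq hpos.ne']
  exact_mod_cast Iff.rfl

theorem valid_toASR [Fintype U] (I : ODTInstance U m) (hm : 2 ≤ m) : I.toASR.Valid := by
  have hm1 : ((m - 1 : ℕ) : ℝ) = (m : ℝ) - 1 := by
    rw [Nat.cast_sub (by omega), Nat.cast_one]
  have hpos : (0 : ℝ) < (m : ℝ) - 1 := by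
    rw [← hm1]
    exact_mod_cast (by omega : 0 < m - 1)
  have hinv : (0 : ℝ) ≤ 1 / ((m : ℝ) - 1) := by positivity
  refine ⟨I.cost_pos, I.prob_nonneg, I.prob_sum, fun i => ⟨fun S => ⟨?_, ?_⟩, ?_, ?_, ?_, ?_⟩⟩
  · rw [toASR_f]
    positivity
  · rw [toASR_f, mul_one_div, div_le_one hpos, ← hm1]
    exact_mod_cast I.card_separated_le i S
  · simp [toASR_f, separated]
  · rw [toASR_f_eq_one_iff I hm]
    intro j hj
    obtain ⟨e, he⟩ := I.identifiable i j hj.symm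
    exact ⟨e, Finset.mem_univ e, he⟩
  · intro S T h
    rw [toASR_f, toASR_f]
    exact mul_le_mul_of_nonneg_right
      (by exact_mod_cast Finset.card_le_card (I.separated_mono i h)) hinv
  · intro S T
    simp only [toASR_f, ← add_mul]
    refine mul_le_mul_of_nonneg_right ?_ hinv
    have h1 : (I.separated i (S ∩ T)).card ≤ (I.separated i S ∩ I.separated i T).card :=
      Finset.card_le_card (Finset.subset_inter (I.separated_mono i Finset.inter_subset_left)
        (I.separated_mono i Finset.inter_subset_right))
    have h2 : I.separated i (S ∪ T) = I.separated i S ∪ I.separated i T :=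
      Finset.union_biUnion
    have h3 := Finset.card_union_add_card_inter (I.separated i S) (I.separated i T)
    rw [h2]
    exact_mod_cast (by omega)

theorem one_le_toASR_f_iff [Fintype U] (I : ODTInstance U m) (hm : 2 ≤ m) (i : Fin m)
    (S : Finset U) : 1 ≤ I.toASR.f i S ↔ I.Identifies S i := by
  rw [← toASR_f_eq_one_iff I hm]
  exact ⟨fun h => le_antisymm (((I.valid_toASR hm).2.2.2 i).1 S).2 h, fun h => h.ge⟩

theorem inv_le_one_sub_f (I : ODTInstance U m) (hm : 2 ≤ m) (i : Fin m) (S : Finset U)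
    (h : I.toASR.f i S < 1) : 1 / ((m : ℝ) - 1) ≤ 1 - I.toASR.f i S := by
  have hm1 : ((m - 1 : ℕ) : ℝ) = (m : ℝ) - 1 := by
    rw [Nat.cast_sub (by omega), Nat.cast_one]
  have hpos : (0 : ℝ) < (m : ℝ) - 1 := by
    rw [← hm1]
    exact_mod_cast (by omega : 0 < m - 1)
  rw [toASR_f, mul_one_div] at h ⊢
  rw [div_lt_one hpos, ← hm1] at h
  have h' : (I.separated i S).card + 1 ≤ m - 1 := by exact_mod_cast h
  have h2 : ((I.separated i S).card : ℝ) + 1 ≤ (m : ℝ) - 1 := by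
    rw [← hm1]
    exact_mod_cast h'
  rw [le_sub_iff_add_le, ← add_div, div_le_one hpos]
  linarith

theorem one_le_f_of_agree [Fintype U] (I : ODTInstance U m) (hm : 2 ≤ m) (i j : Fin m)
    (S : Finset U) (h : ∀ e ∈ S, (e ∈ I.positive i ↔ e ∈ I.positive j))
    (hi : 1 ≤ I.toASR.f i S) : 1 ≤ I.toASR.f j S := by
  rw [one_le_toASR_f_iff I hm] at hi
  by_cases hij : j = i
  · subst hij
    rwa [one_le_toASR_f_iff I hm]
  · obtain ⟨e, he, hne⟩ := hi j hij
    exact absurd (h e he) hne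

/-- Some set of tests separates some hypothesis from all others but one, which a further test
separates as well. -/
theorem exists_card_separated_add_one [Fintype U] (I : ODTInstance U m) (hm : 2 ≤ m) :
    ∃ (i : Fin m) (S : Finset U), (I.separated i S).card + 1 = m - 1 ∧
      ∃ e, (I.separated i (insert e S)).card = m - 1 := by
  -- Choose a pair that separates as many hypotheses as possible without separating all. By
  -- maximality, any further test that separates something new must complete the separation.
  let Q : Finset (Fin m × Finset U) := Finset.univ.filter fun x =>
    (I.separated x.1 x.2).card < m - 1
  have hQ : Q.Nonempty := ⟨(⟨0, by omega⟩, ∅), Finset.mem_filter.2 ⟨Finset.mem_univ _, by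
    rw [separated, Finset.biUnion_empty, Finset.card_empty]
    omega⟩⟩
  obtain ⟨⟨i, S⟩, hiS, hmax⟩ := Q.exists_max_image (fun x => (I.separated x.1 x.2).card) hQ
  simp only [Q, Finset.mem_filter, Finset.mem_univ, true_and, Prod.forall] at hiS hmax
  obtain ⟨j, hj, hjS⟩ : ∃ j, j ≠ i ∧ j ∉ I.separated i S := by
    by_contra! h
    exact hiS.ne ((I.card_separated_eq_iff i S).2 fun j hj => I.mem_separated.1 (h j hj))
  have hagree : ∀ e ∈ S, (e ∈ I.positive i ↔ e ∈ I.positive j) := by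
    intro e he
    by_contra h
    exact hjS (I.mem_separated.2 ⟨e, he, h⟩)
  obtain ⟨e, he⟩ := I.identifiable i j hj.symm
  have hsep : I.separated j S = I.separated i S := by
    ext k
    simp only [mem_separated]
    refine exists_congr fun e' => and_congr_right fun he' => ?_
    rw [hagree e' he']
  have full : ∀ k l, k ≠ l → l ∉ I.separated k S → I.separated k S = I.separated i S →
      ¬ (e ∈ I.positive k ↔ e ∈ I.positive l) →
      (I.separated k (insert e S)).card = m - 1 := by
    intro k l hkl hl hk hel
    by_contra hne
    have hlt' := lt_of_le_of_ne (I.card_separated_le k (insert e S)) hne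
    have h1 := hmax k (insert e S) hlt'
    have h2 : I.separated k S ⊂ I.separated k (insert e S) :=
      (Finset.ssubset_iff_of_subset (I.separated_mono k (Finset.subset_insert _ _))).2
        ⟨l, I.mem_separated.2 ⟨e, Finset.mem_insert_self _ _, hel⟩, hl⟩
    have h3 := Finset.card_lt_card h2
    rw [hk] at h3
    omega
  have hi' := full i j hj.symm hjS rfl he
  have hj' := full j i hj (fun h => by
    rw [hsep] at h
    exact absurd (I.separated_subset i S h) (by simp)) hsep (fun h => he h.symm)
  refine ⟨i, S, ?_, e, hi'⟩
  rw [card_separated_eq_iff] at hi' hj'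
  -- The test `e` is binary and distinguishes `i` from `j`, so any other `k` agrees on it with one
  -- of them. That one is separated from `k` by `S` alone, and `S` separates the same hypotheses
  -- from `i` and from `j`.
  have hsub : (Finset.univ.erase i).erase j ⊆ I.separated i S := by
    intro k hk
    simp only [Finset.mem_erase, Finset.mem_univ, and_true] at hk
    obtain ⟨e1, he1, hk1⟩ := hi' k hk.2
    obtain ⟨e2, he2, hk2⟩ := hj' k hk.1
    rcases Finset.mem_insert.1 he1 with rfl | he1
    · rcases Finset.mem_insert.1 he2 with rfl | he2
      · tauto
      · rw [← hsep]
        exact I.mem_separated.2 ⟨e2, he2, hk2⟩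
    · exact I.mem_separated.2 ⟨e1, he1, hk1⟩
  have hc := Finset.card_le_card hsub
  rw [Finset.card_erase_of_mem (by simp [hj]), Finset.card_erase_of_mem (by simp),
    Finset.card_univ, Fintype.card_fin] at hc
  omega

theorem isLeast_positiveIncrements [Fintype U] (I : ODTInstance U m) (hm : 2 ≤ m) :
    IsLeast I.toASR.positiveIncrements (1 / ((m : ℝ) - 1)) := by
  have hm1 : ((m - 1 : ℕ) : ℝ) = (m : ℝ) - 1 := by
    rw [Nat.cast_sub (by omega), Nat.cast_one]
  have hpos : (0 : ℝ) < (m : ℝ) - 1 := by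
    rw [← hm1]
    exact_mod_cast (by omega : 0 < m - 1)
  have hinv : (0 : ℝ) < 1 / ((m : ℝ) - 1) := by positivity
  constructor
  · obtain ⟨i, S, h1, e, h2⟩ := I.exists_card_separated_add_one hm
    have h3 : ((I.separated i (insert e S)).card : ℝ) = (I.separated i S).card + 1 := by
      exact_mod_cast h2.trans h1.symm
    refine ⟨i, S, e, ?_, ?_⟩ <;> rw [toASR_f, toASR_f, h3] <;> linarith
  · rintro x ⟨i, S, e, h, rfl⟩
    rw [toASR_f, toASR_f] at h ⊢
    have h1 : (I.separated i S).card < (I.separated i (insert e S)).card := by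
      exact_mod_cast lt_of_mul_lt_mul_right h hinv.le
    have h2 : ((I.separated i S).card : ℝ) + 1 ≤ (I.separated i (insert e S)).card := by
      exact_mod_cast h1
    have := mul_le_mul_of_nonneg_right h2 hinv.le
    linarith

theorem isSolution_toASR_iff [Fintype U] (I : ODTInstance U m) (hm : 2 ≤ m) (t : DecTree U) :
    I.toASR.IsSolution t ↔ I.IsSolution t :=
  forall_congr' fun i => I.one_le_toASR_f_iff hm i _

theorem expectedCost_toASR_le (I : ODTInstance U m) (t : DecTree U) :
    I.toASR.expectedCost t ≤ I.expectedCost t :=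
  Finset.sum_le_sum fun i _ => mul_le_mul_of_nonneg_left
    (ASRInstance.coverCost_le (A := I.toASR) I.cost_pos t i) (I.prob_nonneg i)

theorem greedy_factor_le (hm : 2 ≤ m) :
    4 * (Real.logb 2 m + 1 + Real.log (1 / (1 / ((m : ℝ) - 1)))) ≤
      4 * (2 / Real.log 2 + 1) * Real.log m := by
  have hm' : (2 : ℝ) ≤ m := by exact_mod_cast hm
  have hl2 : 0 < Real.log 2 := Real.log_pos (by norm_num)
  have h1 : Real.log 2 ≤ Real.log m := Real.log_le_log (by norm_num) hm'
  have h2 : Real.log ((m : ℝ) - 1) ≤ Real.log m := Real.log_le_log (by linarith) (by linarith)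
  have h3 : 1 ≤ Real.log m / Real.log 2 := by rwa [one_le_div hl2]
  rw [one_div_one_div, ← Real.log_div_log]
  have h4 : 4 * (2 / Real.log 2 + 1) * Real.log m =
      4 * (Real.log m / Real.log 2 + Real.log m / Real.log 2 + Real.log m) := by ring
  -- Since m ≥ 2, both log₂ m and the summand 1 are at most log m / log 2, and log(m-1) ≤ log m;
  -- hence the constant.
  rw [h4]
  linarith

theorem expectedCost_le_of_isGreedyTree [Fintype U] (I : ODTInstance U m) (hm : 2 ≤ m)
    {t s : DecTree U} (ht : I.toASR.IsGreedyTree t) (hs : I.toASR.IsSolution s) :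
    I.expectedCost t ≤
      4 * (2 / Real.log 2 + 1) * Real.log m * I.toASR.expectedCost s := by
  have hm' : (2 : ℝ) ≤ m := by exact_mod_cast hm
  have hA := I.valid_toASR hm
  have h := ht.sum_cost_path_le hA (ε := 1 / ((m : ℝ) - 1)) (one_div_pos.2 (by linarith))
    (by rw [div_le_one] <;> linarith) (I.inv_le_one_sub_f hm) (I.one_le_f_of_agree hm) hs
  rw [Fintype.card_fin] at h
  have h0 : 0 ≤ I.toASR.expectedCost s := Finset.sum_nonneg fun i _ =>
    mul_nonneg (I.prob_nonneg i) (ASRInstance.coverCost_nonneg hA.1 s i)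
  exact le_trans h (mul_le_mul_of_nonneg_right (greedy_factor_le hm) h0)

end ODTInstance

theorem mainTheorem4 :
    ∃ C : ℝ, 0 < C ∧ ∀ (n m : ℕ), 2 ≤ m → ∀ I : ODTInstance (Fin n) m,
      I.toASR.Valid ∧
      (∀ i S, I.toASR.f i S = 1 ↔ I.Identifies S i) ∧
      IsLeast I.toASR.positiveIncrements (1 / ((m : ℝ) - 1)) ∧
      (∃ t, I.toASR.IsGreedyTree t) ∧
      ∀ t, I.toASR.IsGreedyTree t →
        (I.IsSolution t ∧ ∀ s, I.IsSolution s →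
          I.expectedCost t ≤ C * Real.log m * I.expectedCost s) ∧
        (I.toASR.IsSolution t ∧ ∀ s, I.toASR.IsSolution s →
          I.toASR.expectedCost t ≤ C * Real.log m * I.toASR.expectedCost s) := by
  have hC : 0 < 4 * (2 / Real.log 2 + 1) := by
    have : 0 < Real.log 2 := Real.log_pos (by norm_num)
    positivity
  refine ⟨4 * (2 / Real.log 2 + 1), hC, fun n m hm I => ?_⟩
  have hA := I.valid_toASR hm
  have hlog : 0 ≤ Real.log m := Real.log_natCast_nonneg m
  refine ⟨hA, I.toASR_f_eq_one_iff hm, I.isLeast_positiveIncrements hm,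
    ASRInstance.exists_greedyFrom hA _ _ (fun i hi => (Finset.mem_filter.1 hi).2),
    fun t ht => ?_⟩
  have hsol := ht.isSolution hA
  refine ⟨⟨(I.isSolution_toASR_iff hm t).1 hsol, fun s hs => ?_⟩, hsol, fun s hs => ?_⟩
  -- Covering-prefix cost never exceeds full path cost: the first claim weakens the bound on the
  -- side of `s`, the second on the side of `t`.
  · exact (I.expectedCost_le_of_isGreedyTree hm ht ((I.isSolution_toASR_iff hm s).2 hs)).trans
      (mul_le_mul_of_nonneg_left (I.expectedCost_toASR_le s) (mul_nonneg hC.le hlog))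
  · exact (I.expectedCost_toASR_le t).trans (I.expectedCost_le_of_isGreedyTree hm ht hs)
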